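/- Let $\Gamma$ be a finite group and let $C(\Gamma)$ be the $*$-algebra of complex functions on $\Gamma$, with basis $(\delta_g)_{g\in\Gamma}$, convolution product $\delta_g\star\delta_h=\tfrac1{|\Gamma|}\delta_{gh}$ and convolution adjoint $a^\bullet(t)=\overline{a(t^{-1})}$. For a unital $C^*$-algebra $\mathsf B$, a unital $*$-homomorphism $\alpha\colon C(\Gamma)\to C(\Gamma)\otimes\mathsf B$ represents a quantum family of automorphisms of $\Gamma$ if the elements $\alpha(a)(\mathbb 1\otimes b)$, with $a\in C(\Gamma)$ and $b\in\mathsf B$, span $C(\Gamma)\otimes\mathsf B$ (Podleś condition), $\alpha$ is multiplicative with respect to $\star$ on $C(\Gamma)$ and the product $(a\otimes p)(b\otimes q)=(a\star b)\otimes pq$ on $C(\Gamma)\otimes\mathsf B$, $\alpha\circ\bullet=(\bullet\otimes *)\circ\alpha$, and $\alpha(\delta_e)=\delta_e\otimes\mathbb 1$. Such pairs $(\mathsf B,\alpha)$ form a category, in which a morphism $(\mathsf B,\alpha)\to(\mathsf B',\alpha')$ is a unital $*$-homomorphism $\Lambda\colon\mathsf B'\to\mathsf B$ with $(\mathrm{id}\otimes\Lambda)\circ\alpha'=\alpha$.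 The algebra $C(\mathrm{qAut}(\Gamma))$ of the quantum automorphism group $\mathrm{qAut}(\Gamma)$ is the algebra $\mathsf B_u$ of the final object $(\mathsf B_u,\alpha_u)$ of this category, and $\mathrm{qAut}(\Gamma)$ is called classical if this $C^*$-algebra is commutative. Theorem. Let $\Gamma$ be a finite cyclic group. Then the quantum automorphism group of $\Gamma$ is classical; that is, the final object $(\mathsf B_u,\alpha_u)$ exists and for every final object the $C^*$-algebra $\mathsf B_u=C(\mathrm{qAut}(\Gamma))$ is commutative. -/

import Mathlib

open scoped TensorProduct

universe u v

noncomputable section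

namespace QuantumAut

section Family

variable (Γ : Type v) [Group Γ] [Fintype Γ]

/-- The algebra `C(Γ)` of complex functions on the finite group `Γ`, with its pointwise
`*`-algebra structure. -/
abbrev Fun : Type v := Γ → ℂ

/-- The convolution product on `C(Γ)` with respect to the Haar state (the normalised counting
measure): `(a ⋆ b)(t) = |Γ|⁻¹ ∑ₛ a(s) b(s⁻¹ t)`; thus `δ_g ⋆ δ_h = |Γ|⁻¹ δ_{gh}`. -/
def convMul : Fun Γ →ₗ[ℂ] Fun Γ →ₗ[ℂ] Fun Γ :=
  LinearMap.mk₂ ℂ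
    (fun a b t => (Fintype.card Γ : ℂ)⁻¹ * ∑ s : Γ, a s * b (s⁻¹ * t))
    (fun a a' b => by
      funext t
      simp [add_mul, Finset.sum_add_distrib, mul_add])
    (fun c a b => by
      funext t
      simp only [Pi.smul_apply, smul_eq_mul, Finset.mul_sum]
      exact Finset.sum_congr rfl fun s _ => by ring)
    (fun a b b' => by
      funext t
      simp [Finset.sum_add_distrib, mul_add])
    (fun c a b => by
      funext t
      simp only [Pi.smul_apply, smul_eq_mul, Finset.mul_sum]
      exact Finset.sum_congr rfl fun s _ => by ring)

/-- The convolution adjoint `a^•(t) = conj (a (t⁻¹))` on `C(Γ)`, as a conjugate-linear map. -/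
def convAdj : Fun Γ →ₗ⋆[ℂ] Fun Γ where
  toFun a t := star (a t⁻¹)
  map_add' a b := by
    funext t
    simp
  map_smul' c a := by
    funext t
    simp

variable [DecidableEq Γ]

/-- The Haar element `δ_e` of `C(Γ)`. -/
def haarElement : Fun Γ := Pi.single 1 1

variable (B : Type u) [CStarAlgebra B]

/-- The convolution product on the first leg of `C(Γ) ⊗ B` combined with the product of `B` on the
second one: `(a ⊗ p)(b ⊗ q) = (a ⋆ b) ⊗ pq`. -/
def convMulTensor : (Fun Γ ⊗[ℂ] B) →ₗ[ℂ] (Fun Γ ⊗[ℂ] B) →ₗ[ℂ] (Fun Γ ⊗[ℂ] B) :=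
  TensorProduct.map₂ (convMul Γ) (LinearMap.mul ℂ B)

/-- The conjugate-linear map `• ⊗ *` on `C(Γ) ⊗ B`. -/
def convAdjTensor : (Fun Γ ⊗[ℂ] B) →ₗ⋆[ℂ] (Fun Γ ⊗[ℂ] B) :=
  TensorProduct.map (convAdj Γ) (starLinearEquiv ℂ (A := B)).toLinearMap

variable {Γ B}

/-- A unital `*`-homomorphism `α : C(Γ) → C(Γ) ⊗ B` represents a quantum family of automorphisms
of `Γ` indexed by `B` if it satisfies the Podleś condition and preserves the convolution structure
(product, adjoint and Haar element). As `C(Γ)` is finite dimensional, the algebraic tensor product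
`C(Γ) ⊗ B` is the `C*`-algebraic one. -/
structure IsQuantumFamilyOfAut (α : Fun Γ →⋆ₐ[ℂ] Fun Γ ⊗[ℂ] B) : Prop where
  podles : Submodule.span ℂ
    {t : Fun Γ ⊗[ℂ] B | ∃ (a : Fun Γ) (b : B), t = α a * ((1 : Fun Γ) ⊗ₜ[ℂ] b)} = ⊤
  map_convMul : ∀ a b : Fun Γ, α (convMul Γ a b) = convMulTensor Γ B (α a) (α b)
  map_convAdj : ∀ a : Fun Γ, α (convAdj Γ a) = convAdjTensor Γ B (α a)
  map_haarElement : α (haarElement Γ) = haarElement Γ ⊗ₜ[ℂ] (1 : B)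

end Family

/-- Objects of the category of quantum families of automorphisms of `Γ`. -/
structure QAUT (Γ : Type v) [Group Γ] [Fintype Γ] [DecidableEq Γ] where
  /-- The parametrising unital `C*`-algebra. -/
  B : Type u
  [cstar : CStarAlgebra B]
  /-- The quantum family. -/
  α : Fun Γ →⋆ₐ[ℂ] Fun Γ ⊗[ℂ] B
  isFamily : IsQuantumFamilyOfAut α

attribute [instance] QAUT.cstar

namespace QAUT

variable {Γ : Type v} [Group Γ] [Fintype Γ] [DecidableEq Γ]

/-- A morphism `(B, α) ⟶ (B', α')` is a unital `*`-homomorphism `Λ : B' → B` (note the direction)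
with `(id ⊗ Λ) ∘ α' = α`. -/
@[ext]
structure Hom (X Y : QAUT.{u, v} Γ) where
  /-- The underlying unital `*`-homomorphism. -/
  Λ : Y.B →⋆ₐ[ℂ] X.B
  intertwines : ∀ a : Fun Γ, (Λ.toAlgHom.toLinearMap).lTensor (Fun Γ) (Y.α a) = X.α a

instance : CategoryTheory.Category.{u} (QAUT.{u, v} Γ) where
  Hom X Y := Hom X Y
  id X :=
    { Λ := StarAlgHom.id ℂ X.B
      intertwines := fun a => LinearMap.lTensor_id_apply (Fun Γ) X.B (X.α a) }
  comp {X Y Z} f g :=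
    { Λ := f.Λ.comp g.Λ
      intertwines := fun a => by
        have h := LinearMap.lTensor_comp_apply (Fun Γ) f.Λ.toAlgHom.toLinearMap
          g.Λ.toAlgHom.toLinearMap (Z.α a)
        rw [g.intertwines, f.intertwines] at h
        exact h }

/-- The compact quantum group with function algebra `X.B` is classical: its `C*`-algebra is
commutative. -/
def IsClassical (X : QAUT.{u, v} Γ) : Prop :=
  ∀ p q : X.B, p * q = q * p

end QAUT

end QuantumAut

end

/-!
Write `α(δ_h) = ∑_g δ_g ⊗ u_{g,h}`. Each row of the matrix `u` consists of orthogonal projections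
with sum `1`. Compatibility with the convolution gives `u_{t,gh} = ∑_s u_{s,g} u_{s⁻¹t,h}`;
together with `u_{g⁻¹,h⁻¹} = u_{g,h}` and `u_{e,e} = 1`, the case `t = e`, `h = g⁻¹` shows that the
columns add up to `1`, so that in a `C*`-algebra they too consist of orthogonal projections.
Multiplying the convolution identity by `u_{s,a}` then yields
`u_{s,a} u_{t,ab} = u_{s,a} u_{s⁻¹t,b}` (`IsQuantumFamilyOfAut.entry_mul_entry_mul`).

If `z` generates `Γ`, induction gives `u_{z,a} u_{z^k,b} = u_{z,a}` for `b = a^k` and `0` otherwise,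
and summing over `a` expresses every row through the row of `z`
(`IsQuantumFamilyOfAut.slice_pow`), whose entries commute with each other. Moreover `u_{z,a} = 0`
unless `a` is a generator (`IsQuantumFamilyOfAut.exists_mulEquiv_of_entry_ne_zero`), that is, unless
`a = φ(z)` for a (unique) automorphism `φ`. Hence the projections `u_{z,φ(z)}` are orthogonal with
sum `1`, and `δ_φ ↦ u_{z,φ(z)}` defines the unique homomorphism `C(Aut Γ) → B` that carries the
family of all classical automorphisms to `α`. So `C(Aut Γ)` is a final object, and every final
object is isomorphic to it.
-/

open scoped TensorProduct

namespace QuantumAut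

noncomputable section

/-! ### Slice maps on `C(Γ) ⊗ B` -/

section Slice

variable {Γ : Type v} {B : Type u} [CStarAlgebra B]

/-- The slice map `ev_g ⊗ id : C(Γ) ⊗ B → B`, where `ev_g` is evaluation at `g`. -/
def slice (g : Γ) : (Γ → ℂ) ⊗[ℂ] B →⋆ₐ[ℂ] B where
  __ := Algebra.TensorProduct.lift ((Algebra.ofId ℂ B).comp (Pi.evalAlgHom ℂ (fun _ : Γ => ℂ) g))
    (AlgHom.id ℂ B) fun a b => Algebra.commutes (a g) b
  map_star' x := by
    induction x with
    | zero => simp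
    | add x y hx hy => simp_all
    | tmul a b =>
      change algebraMap ℂ B (star (a g)) * star b = star (algebraMap ℂ B (a g) * b)
      rw [star_mul, ← algebraMap_star_comm, Algebra.commutes]

@[simp]
lemma slice_tmul (g : Γ) (a : Γ → ℂ) (b : B) : slice g (a ⊗ₜ[ℂ] b) = a g • b :=
  (Algebra.smul_def (a g) b).symm

lemma slice_lTensor {B' : Type*} [CStarAlgebra B'] (f : B →⋆ₐ[ℂ] B') (g : Γ)
    (x : (Γ → ℂ) ⊗[ℂ] B) :
    slice g (f.toAlgHom.toLinearMap.lTensor (Γ → ℂ) x) = f (slice g x) := by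
  induction x with
  | zero => simp
  | add x y hx hy => simp only [map_add, hx, hy]
  | tmul a b => simp

section Group

variable [Group Γ]

lemma slice_convAdjTensor (x : Fun Γ ⊗[ℂ] B) (t : Γ) :
    slice t (convAdjTensor Γ B x) = star (slice t⁻¹ x) := by
  induction x with
  | zero => simp
  | add x y hx hy => simp only [map_add, hx, hy, star_add]
  | tmul a b => simp [convAdjTensor, convAdj]

end Group

variable [Fintype Γ]

lemma sum_single_tmul_slice [DecidableEq Γ] (x : (Γ → ℂ) ⊗[ℂ] B) :
    ∑ g : Γ, (Pi.single g 1 : Γ → ℂ) ⊗ₜ[ℂ] slice g x = x := by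
  induction x with
  | zero => simp
  | add x y hx hy => simp [TensorProduct.tmul_add, Finset.sum_add_distrib, hx, hy]
  | tmul a b =>
    simp only [slice_tmul, ← TensorProduct.smul_tmul, ← TensorProduct.sum_tmul]
    congr 1
    funext t
    simp [Finset.sum_apply, Pi.single_apply]

lemma ext_slice {x y : (Γ → ℂ) ⊗[ℂ] B} (h : ∀ g, slice g x = slice g y) : x = y := by
  classical
  rw [← sum_single_tmul_slice x, ← sum_single_tmul_slice y]
  simp only [h]

variable [Group Γ]

lemma slice_convMulTensor (x y : Fun Γ ⊗[ℂ] B) (t : Γ) :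
    slice t (convMulTensor Γ B x y) =
      (Fintype.card Γ : ℂ)⁻¹ • ∑ s : Γ, slice s x * slice (s⁻¹ * t) y := by
  induction x with
  | zero => simp
  | add x x' hx hx' =>
    simp only [map_add, LinearMap.add_apply, hx, hx', add_mul, Finset.sum_add_distrib, smul_add]
  | tmul a p =>
    induction y with
    | zero => simp
    | add y y' hy hy' => simp only [map_add, hy, hy', mul_add, Finset.sum_add_distrib, smul_add]
    | tmul b q =>
      simp only [convMulTensor, TensorProduct.map₂_apply_tmul, TensorProduct.map_tmul, slice_tmul,
        convMul, LinearMap.mk₂_apply, LinearMap.mul_apply', smul_mul_smul_comm, mul_smul _ (∑ _, _),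
        Finset.sum_smul]

end Slice

/-! ### The matrix of a quantum family of automorphisms -/

section Entries

variable {Γ : Type v} [DecidableEq Γ] {B : Type u} [CStarAlgebra B]

/-- The entries `u_{g,h}` of the matrix of `α`, characterised by `α(δ_h) = ∑_g δ_g ⊗ u_{g,h}`.
For a family of honest maps `φ`, `u_{g,h}` is the indicator function of `φ(g) = h`. -/
def entry (α : Fun Γ →⋆ₐ[ℂ] Fun Γ ⊗[ℂ] B) (g h : Γ) : B := slice g (α (Pi.single h 1))

variable {α : Fun Γ →⋆ₐ[ℂ] Fun Γ ⊗[ℂ] B}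

lemma entry_mul_self (g h : Γ) : entry α g h * entry α g h = entry α g h := by
  rw [entry, ← map_mul, ← map_mul, ← Pi.single_mul, one_mul]

lemma star_entry (g h : Γ) : star (entry α g h) = entry α g h := by
  have : star (Pi.single h 1 : Fun Γ) = Pi.single h 1 := by
    rw [← Pi.single_star, star_one]
  rw [entry, ← map_star, ← map_star, this]

lemma entry_mul_entry_of_ne (g : Γ) {h h' : Γ} (hh : h ≠ h') :
    entry α g h * entry α g h' = 0 := by
  have : (Pi.single h 1 * Pi.single h' 1 : Fun Γ) = 0 := by
    funext t
    simp only [Pi.single_apply, Pi.mul_apply, Pi.zero_apply]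
    aesop
  rw [entry, entry, ← map_mul, ← map_mul, this, map_zero, map_zero]

variable [Fintype Γ]

lemma slice_apply_eq_sum (α : Fun Γ →⋆ₐ[ℂ] Fun Γ ⊗[ℂ] B) (g : Γ) (f : Fun Γ) :
    slice g (α f) = ∑ a, f a • entry α g a := by
  conv_lhs => rw [pi_eq_sum_univ' f]
  simp [entry]

lemma sum_entry_row (g : Γ) : ∑ a, entry α g a = 1 := by
  simpa using (slice_apply_eq_sum α g 1).symm

/-- Orthogonality of projections adding up to `1`: compressing `∑ q_i = 1` by one of them leaves a
vanishing sum of positive elements. -/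
lemma mul_eq_zero_of_sum_eq_one {ι : Type*} [Fintype ι] [DecidableEq ι] {q : ι → B}
    (hq : ∀ i, q i * q i = q i) (hq' : ∀ i, star (q i) = q i) (hsum : ∑ i, q i = 1)
    {i j : ι} (hij : i ≠ j) : q i * q j = 0 := by
  let _ := CStarAlgebra.spectralOrder B
  let _ := CStarAlgebra.spectralOrderedRing B
  have key : ∀ k, q j * q k * q j = star (q k * q j) * (q k * q j) := fun k => by
    rw [star_mul, hq', hq', mul_assoc, mul_assoc, ← mul_assoc (q k) (q k), hq]
  have h0 : ∑ k ∈ Finset.univ.erase j, star (q k * q j) * (q k * q j) = 0 := by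
    have h1 : ∑ k, q j * q k * q j = q j := by
      rw [← Finset.sum_mul, ← Finset.mul_sum, hsum, mul_one, hq]
    rw [← Finset.add_sum_erase _ _ (Finset.mem_univ j), hq, hq] at h1
    simpa [key] using h1
  have h2 := (Finset.sum_eq_zero_iff_of_nonneg fun k _ => star_mul_self_nonneg _).1 h0 i
    (Finset.mem_erase.2 ⟨hij, Finset.mem_univ i⟩)
  exact (CStarRing.star_mul_self_eq_zero_iff _).1 h2

variable [Group Γ]

namespace IsQuantumFamilyOfAut

variable (hα : IsQuantumFamilyOfAut α)
include hα

lemma entry_one_right (g : Γ) : entry α g 1 = if g = 1 then 1 else 0 := by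
  have h := congrArg (slice g) hα.map_haarElement
  rw [haarElement, slice_tmul] at h
  rw [entry, h, Pi.single_apply, ite_smul, one_smul, zero_smul]

lemma entry_one_left (h : Γ) : entry α 1 h = if h = 1 then 1 else 0 := by
  split_ifs with hh
  · rw [hh, hα.entry_one_right, if_pos rfl]
  · have := entry_mul_entry_of_ne (α := α) 1 hh
    rwa [hα.entry_one_right, if_pos rfl, mul_one] at this

lemma entry_mul_right (t g h : Γ) :
    entry α t (g * h) = ∑ s, entry α s g * entry α (s⁻¹ * t) h := by
  have h1 : convMul Γ (Pi.single g 1) (Pi.single h 1) =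
      (Fintype.card Γ : ℂ)⁻¹ • (Pi.single (g * h) 1 : Fun Γ) := by
    funext t
    rw [convMul, LinearMap.mk₂_apply, Finset.sum_eq_single g]
    · simp [Pi.single_apply, inv_mul_eq_iff_eq_mul]
    · intro s _ hs
      rw [Pi.single_eq_of_ne hs, zero_mul]
    · simp
  have h2 := congrArg (slice t) (hα.map_convMul (Pi.single g 1) (Pi.single h 1))
  rw [h1, slice_convMulTensor, map_smul, map_smul] at h2
  exact smul_right_injective B (inv_ne_zero (Nat.cast_ne_zero.2 Fintype.card_ne_zero)) h2

lemma entry_inv_inv (g h : Γ) : entry α g⁻¹ h⁻¹ = entry α g h := by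
  have h1 : convAdj Γ (Pi.single h 1) = (Pi.single h⁻¹ 1 : Fun Γ) := by
    funext t
    simp [convAdj, Pi.single_apply, inv_eq_iff_eq_inv, apply_ite]
  have h2 := congrArg (slice g⁻¹) (hα.map_convAdj (Pi.single h 1))
  rw [h1, slice_convAdjTensor, inv_inv] at h2
  exact h2.trans (star_entry g h)

lemma sum_entry_column (h : Γ) : ∑ g, entry α g h = 1 := by
  have h1 := hα.entry_mul_right 1 h h⁻¹
  simp only [mul_inv_cancel, mul_one, hα.entry_inv_inv, entry_mul_self] at h1
  rw [← h1, hα.entry_one_right, if_pos rfl]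

lemma entry_mul_entry_of_ne_column {g g' : Γ} (h : Γ) (hg : g ≠ g') :
    entry α g h * entry α g' h = 0 :=
  mul_eq_zero_of_sum_eq_one (q := fun s => entry α s h) (fun _ => entry_mul_self _ _)
    (fun _ => star_entry _ _) (hα.sum_entry_column h) hg

/-- Where `s` is sent to `a`, an element `t` is sent to `a * b` exactly if `s⁻¹ * t` is sent
to `b`. -/
lemma entry_mul_entry_mul (s t a b : Γ) :
    entry α s a * entry α t (a * b) = entry α s a * entry α (s⁻¹ * t) b := by
  rw [hα.entry_mul_right, Finset.mul_sum, Finset.sum_eq_single s]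
  · rw [← mul_assoc, entry_mul_self]
  · intro s' _ hs
    rw [← mul_assoc, hα.entry_mul_entry_of_ne_column a hs.symm, zero_mul]
  · simp

/-- Where `z` is sent to `a`, the power `z ^ k` is sent to `a ^ k`. -/
lemma entry_mul_entry_pow (z a : Γ) (k : ℕ) (b : Γ) :
    entry α z a * entry α (z ^ k) b = if b = a ^ k then entry α z a else 0 := by
  induction k generalizing b with
  | zero => rw [pow_zero, pow_zero, hα.entry_one_left, mul_ite, mul_one, mul_zero]
  | succ k ih =>
    have h := hα.entry_mul_entry_mul z (z ^ (k + 1)) a (a⁻¹ * b)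
    rw [mul_inv_cancel_left, pow_succ', inv_mul_cancel_left, ih] at h
    simp only [pow_succ', h, inv_mul_eq_iff_eq_mul]

/-- The entries in the row of `z ^ k` are determined by those in the row of `z`. -/
lemma slice_pow (z : Γ) (k : ℕ) (f : Fun Γ) :
    slice (z ^ k) (α f) = slice z (α fun a => f (a ^ k)) := by
  rw [← one_mul (slice (z ^ k) (α f)), ← sum_entry_row (α := α) z, Finset.sum_mul,
    slice_apply_eq_sum, slice_apply_eq_sum]
  refine Finset.sum_congr rfl fun a _ => ?_
  simp only [Finset.mul_sum, mul_smul_comm, hα.entry_mul_entry_pow, smul_ite, smul_zero,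
    Finset.sum_ite_eq', Finset.mem_univ, if_true]

/-- A generator can only be sent to a generator: on the support of `u_{z,a}` the element `z ^ m`
with `m` the order of `a` is sent to `1`, which only `1` is. -/
lemma exists_mulEquiv_of_entry_ne_zero {z a : Γ} (hz : ∀ x, x ∈ Subgroup.zpowers z)
    (ha : entry α z a ≠ 0) : ∃ φ : Γ ≃* Γ, φ z = a := by
  have hza : z ^ orderOf a = 1 := by
    by_contra hne
    have h := hα.entry_mul_entry_pow z a (orderOf a) 1
    rw [pow_orderOf_eq_one, if_pos rfl, hα.entry_one_right, if_neg hne, mul_zero] at h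
    exact ha h.symm
  have hcard : orderOf z = Nat.card Γ := orderOf_eq_card_of_forall_mem_zpowers hz
  have hord : orderOf a = Nat.card Γ :=
    Nat.dvd_antisymm (orderOf_dvd_natCard a) (hcard ▸ orderOf_dvd_of_pow_eq_one hza)
  have ha' : ∀ x, x ∈ Subgroup.zpowers a := fun x => by
    rw [(Subgroup.zpowers a).eq_top_of_card_eq ((Nat.card_zpowers a).trans hord)]
    exact Subgroup.mem_top x
  exact ⟨mulEquivOfOrderOfEq hz ha' (hcard.trans hord.symm), by simp⟩

/-- The value of `slice z ∘ α` depends only on the restriction of a function to generators. -/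
lemma slice_congr {z : Γ} (hz : ∀ x, x ∈ Subgroup.zpowers z) {f f' : Fun Γ}
    (h : ∀ φ : Γ ≃* Γ, f (φ z) = f' (φ z)) : slice z (α f) = slice z (α f') := by
  rw [slice_apply_eq_sum, slice_apply_eq_sum]
  refine Finset.sum_congr rfl fun a _ => ?_
  by_cases ha : entry α z a = 0
  · rw [ha, smul_zero, smul_zero]
  · obtain ⟨φ, rfl⟩ := hα.exists_mulEquiv_of_entry_ne_zero hz ha
    rw [h]

end IsQuantumFamilyOfAut

end Entries

/-! ### Classical families of automorphisms -/

section ClassicalFamily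

variable {Γ : Type v} [Group Γ] [Fintype Γ] [DecidableEq Γ] {K : Type u} [Fintype K]

/-- The classical family `α(a)(g)(k) = a(φ_k(g))` of automorphisms `φ_k` of `Γ`, with a finite
parameter set `K`. -/
def classicalFamily (e : K → Γ ≃* Γ) : Fun Γ →⋆ₐ[ℂ] Fun Γ ⊗[ℂ] (K → ℂ) :=
  let F : Fun Γ → Fun Γ ⊗[ℂ] (K → ℂ) := fun a =>
    ∑ g, (Pi.single g 1 : Fun Γ) ⊗ₜ[ℂ] fun k => a (e k g)
  have hF : ∀ g a, slice g (F a) = fun k => a (e k g) := fun g a => by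
    simp [F, Pi.single_apply]
  { toFun := F
    map_one' := ext_slice fun g => by rw [hF, map_one]; rfl
    map_mul' := fun a b => ext_slice fun g => by rw [map_mul, hF, hF, hF]; rfl
    map_zero' := ext_slice fun g => by rw [hF, map_zero]; rfl
    map_add' := fun a b => ext_slice fun g => by rw [map_add, hF, hF, hF]; rfl
    commutes' := fun c => ext_slice fun g => by rw [hF, AlgHomClass.commutes]; rfl
    map_star' := fun a => ext_slice fun g => by rw [map_star, hF, hF]; rfl }

lemma slice_classicalFamily (e : K → Γ ≃* Γ) (g : Γ) (a : Fun Γ) :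
    slice g (classicalFamily e a) = fun k => a (e k g) := by
  simp [classicalFamily, Pi.single_apply]

lemma isQuantumFamilyOfAut_classicalFamily (e : K → Γ ≃* Γ) :
    IsQuantumFamilyOfAut (classicalFamily e) where
  podles := by
    classical
    refine Submodule.eq_top_iff'.2 fun x => ?_
    -- `δ_g ⊗ δ_k = α(δ_{φ_k(g)}) (1 ⊗ δ_k)`
    have key : ∀ (g : Γ) (k : K), (Pi.single g 1 : Fun Γ) ⊗ₜ[ℂ] (Pi.single k 1 : K → ℂ) =
        classicalFamily e (Pi.single (e k g) 1) * (1 ⊗ₜ[ℂ] Pi.single k 1) := fun g k =>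
      ext_slice fun g' => by
        rw [map_mul, slice_classicalFamily, slice_tmul, slice_tmul]
        funext k'
        by_cases hk : k' = k
        · subst hk; simp [Pi.single_apply]
        · simp [hk]
    rw [← sum_single_tmul_slice x]
    refine Submodule.sum_mem _ fun g _ => ?_
    rw [pi_eq_sum_univ' (slice g x), TensorProduct.tmul_sum]
    refine Submodule.sum_mem _ fun k _ => ?_
    rw [TensorProduct.tmul_smul]
    refine Submodule.smul_mem _ _ (Submodule.subset_span
      ⟨Pi.single (e k g) 1, Pi.single k 1, ?_⟩)
    rw [← key]
  map_convMul a b := ext_slice fun t => by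
    rw [slice_convMulTensor]
    simp only [slice_classicalFamily]
    funext k
    simp only [convMul, LinearMap.mk₂_apply, Pi.smul_apply, Finset.sum_apply, Pi.mul_apply,
      smul_eq_mul, map_mul, map_inv]
    rw [← (e k).toEquiv.sum_comp]
    rfl
  map_convAdj a := ext_slice fun t => by
    rw [slice_convAdjTensor, slice_classicalFamily, slice_classicalFamily]
    funext k
    simp [convAdj]
  map_haarElement := ext_slice fun t => by
    rw [slice_classicalFamily, slice_tmul]
    funext k
    simp [haarElement, Pi.single_apply]

/-- The object of `QAUT Γ` given by a classical family. -/
def classicalObject (e : K → Γ ≃* Γ) : QAUT.{u, v} Γ where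
  B := K → ℂ
  α := classicalFamily e
  isFamily := isQuantumFamilyOfAut_classicalFamily e

end ClassicalFamily

/-! ### The final object for a cyclic group -/

section Universal

variable {Γ : Type v} [Group Γ] {K : Type u}

lemma injective_apply_generator (e : K ≃ (Γ ≃* Γ)) {z : Γ} (hz : ∀ x, x ∈ Subgroup.zpowers z) :
    Function.Injective fun k => e k z := fun k l hkl => e.injective <| MulEquiv.ext fun x => by
  obtain ⟨n, rfl⟩ := hz x
  simpa using congrArg (· ^ n) hkl

variable [Fintype Γ] [DecidableEq Γ]

/-- The map `C(Aut Γ) → B` induced by a quantum family: a function on `Aut Γ` is a function on the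
set of generators of `Γ` by `φ ↦ φ(z)`, hence, extended by zero, a function on `Γ`, to which the
row `slice z ∘ α` of the generator `z` applies. Here `K` is a copy of `Aut Γ`, identified with it
through `e`, in the universe of the parametrising algebras. -/
def inducedHom (e : K ≃ (Γ ≃* Γ)) {z : Γ} (hz : ∀ x, x ∈ Subgroup.zpowers z) {B : Type*}
    [CStarAlgebra B] {α : Fun Γ →⋆ₐ[ℂ] Fun Γ ⊗[ℂ] B} (hα : IsQuantumFamilyOfAut α) :
    (K → ℂ) →⋆ₐ[ℂ] B :=
  let E : (K → ℂ) → Fun Γ := fun f => Function.extend (fun k => e k z) f 0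
  have hE : ∀ (f : K → ℂ) (φ : Γ ≃* Γ), E f (φ z) = f (e.symm φ) := fun f φ => by
    simpa using (injective_apply_generator e hz).extend_apply f 0 (e.symm φ)
  { toFun := fun f => slice z (α (E f))
    map_one' := by
      refine (hα.slice_congr (f' := 1) hz fun φ => hE _ φ).trans ?_
      rw [map_one, map_one]
    map_mul' := fun f f' => by
      rw [← map_mul, ← map_mul]
      exact hα.slice_congr hz fun φ => by simp [hE]
    map_zero' := by
      refine (hα.slice_congr (f' := 0) hz fun φ => hE _ φ).trans ?_
      rw [map_zero, map_zero]
    map_add' := fun f f' => by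
      rw [← map_add, ← map_add]
      exact hα.slice_congr hz fun φ => by simp [hE]
    commutes' := fun c => by
      refine (hα.slice_congr (f' := algebraMap ℂ (Fun Γ) c) hz fun φ => hE _ φ).trans ?_
      rw [AlgHomClass.commutes, AlgHomClass.commutes]
    map_star' := fun f => by
      rw [← map_star, ← map_star]
      exact hα.slice_congr hz fun φ => by simp [hE] }

lemma inducedHom_apply (e : K ≃ (Γ ≃* Γ)) {z : Γ} (hz : ∀ x, x ∈ Subgroup.zpowers z)
    {B : Type*} [CStarAlgebra B] {α : Fun Γ →⋆ₐ[ℂ] Fun Γ ⊗[ℂ] B} (hα : IsQuantumFamilyOfAut α)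
    (f : Fun Γ) : inducedHom e hz hα (fun k => f (e k z)) = slice z (α f) :=
  hα.slice_congr hz fun φ => by
    simpa using (injective_apply_generator e hz).extend_apply (fun k => f (e k z)) 0 (e.symm φ)

variable [Fintype K]

lemma lTensor_inducedHom (e : K ≃ (Γ ≃* Γ)) {z : Γ} (hz : ∀ x, x ∈ Subgroup.zpowers z)
    {B : Type*} [CStarAlgebra B] {α : Fun Γ →⋆ₐ[ℂ] Fun Γ ⊗[ℂ] B} (hα : IsQuantumFamilyOfAut α)
    (f : Fun Γ) :
    (inducedHom e hz hα).toAlgHom.toLinearMap.lTensor (Fun Γ) (classicalFamily e f) = α f :=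
  ext_slice fun g => by
    obtain ⟨n, rfl⟩ := mem_powers_iff_mem_zpowers.2 (hz g)
    dsimp only
    rw [slice_lTensor, slice_classicalFamily, hα.slice_pow, ← inducedHom_apply e hz hα]
    simp

/-- A homomorphism on `C(Aut Γ)` is determined by its composition with the universal family, as
every function on `Aut Γ` is a coefficient of that family in the row of a generator. -/
lemma eq_inducedHom (e : K ≃ (Γ ≃* Γ)) {z : Γ} (hz : ∀ x, x ∈ Subgroup.zpowers z)
    {B : Type*} [CStarAlgebra B] {α : Fun Γ →⋆ₐ[ℂ] Fun Γ ⊗[ℂ] B} (hα : IsQuantumFamilyOfAut α)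
    {Λ : (K → ℂ) →⋆ₐ[ℂ] B}
    (hΛ : ∀ f, Λ.toAlgHom.toLinearMap.lTensor (Fun Γ) (classicalFamily e f) = α f) :
    Λ = inducedHom e hz hα := by
  refine StarAlgHom.ext fun f => ?_
  obtain ⟨a, rfl⟩ : ∃ a : Fun Γ, f = fun k => a (e k z) :=
    ⟨Function.extend (fun k => e k z) f 0, funext fun k =>
      ((injective_apply_generator e hz).extend_apply f 0 k).symm⟩
  rw [inducedHom_apply, ← hΛ, slice_lTensor, slice_classicalFamily]

/-- For a cyclic group the family of all classical automorphisms is a final object. -/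
def isTerminalClassicalObject (e : K ≃ (Γ ≃* Γ)) {z : Γ} (hz : ∀ x, x ∈ Subgroup.zpowers z) :
    CategoryTheory.Limits.IsTerminal (classicalObject e) :=
  CategoryTheory.Limits.IsTerminal.ofUniqueHom
    (fun X => { Λ := inducedHom e hz X.isFamily, intertwines := lTensor_inducedHom e hz X.isFamily })
    fun X m => QAUT.Hom.ext (eq_inducedHom e hz X.isFamily m.intertwines)

/-- If `f ≫ g = 𝟙 X`, the homomorphism `Y.B → X.B` underlying `f` is surjective, so commutativity
passes from `Y.B` to `X.B`. -/
lemma QAUT.IsClassical.of_retract {X Y : QAUT.{u, v} Γ} (hY : Y.IsClassical) (f : X ⟶ Y)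
    (g : Y ⟶ X) (h : CategoryTheory.CategoryStruct.comp f g = CategoryTheory.CategoryStruct.id X) :
    X.IsClassical := fun p q => by
  have hfg : ∀ x : X.B, f.Λ (g.Λ x) = x := fun x =>
    congrArg (fun m : QAUT.Hom X X => m.Λ x) h
  rw [← hfg p, ← hfg q, ← map_mul f.Λ, hY, map_mul]

end Universal

end

end QuantumAut

theorem mainTheorem3 (Γ : Type v) [Group Γ] [Fintype Γ] [DecidableEq Γ] [IsCyclic Γ] :
    CategoryTheory.Limits.HasTerminal (QuantumAut.QAUT.{u, v} Γ) ∧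
      ∀ X : QuantumAut.QAUT.{u, v} Γ,
        CategoryTheory.Limits.IsTerminal X → X.IsClassical := by
  obtain ⟨z, hz⟩ := IsCyclic.exists_generator (α := Γ)
  -- a finite copy of `Aut Γ` in the universe of the parametrising algebras
  let e : ULift.{u} (Fin (Nat.card (Γ ≃* Γ))) ≃ (Γ ≃* Γ) :=
    Equiv.ulift.trans (Finite.equivFin (Γ ≃* Γ)).symm
  have hterm := QuantumAut.isTerminalClassicalObject e hz
  refine ⟨hterm.hasTerminal, fun X hX => ?_⟩
  exact QuantumAut.QAUT.IsClassical.of_retract (Y := QuantumAut.classicalObject e)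
    (fun p q => mul_comm (G := ULift.{u} (Fin (Nat.card (Γ ≃* Γ))) → ℂ) p q)
    (hterm.from X) (hX.from _) (hX.hom_ext _ _)
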